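/- For real numbers $\theta,\phi$ let $$L(\theta,\phi)=\liminf_{|q|\to\infty,\ q\in\mathbb Z} |q|\,\|q\theta-\phi\|,$$ where $\|x\|$ denotes the distance from the real number $x$ to the nearest integer. Let $k\ge 1$ and $n\ge 2$ be integers with $\gcd(n,k)\ne 1$. Then $$n^2\,L\big(e^{2/k},\,1/n\big)=n^2\,L\big(e^{2/k},\,-e^{2/k}/n\big)=\tfrac12 .$$ -/

import Mathlib

open Filter

open scoped ENNReal

/-- The distance from the real number `x` to the nearest integer. -/
noncomputable def distNearestInt (x : ℝ) : ℝ := |x - round x|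

/-- The inhomogeneous approximation constant of `θ` and `φ`: the lower limit, as `|q| → ∞` over the
integers `q`, of `|q|` times the distance from `q θ - φ` to the nearest integer. The lower limit of
these nonnegative quantities is taken in `[0, ∞]`, where it always exists. -/
noncomputable def inhomApproxConst (θ φ : ℝ) : ℝ≥0∞ :=
  liminf (fun q : ℤ => ENNReal.ofReal (|(q : ℝ)| * distNearestInt ((q : ℝ) * θ - φ)))
    (comap (fun q : ℤ => |q|) atTop)

/-!
Multiplying by `n` turns the claim into one about homogeneous approximation: up to a factor tending
to `1`, `n ^ 2 * |q| * ‖q * θ - φ‖` is `|Q| * |Q * θ - P|` for `θ = exp (2 / k)` and integers with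
`(P, Q)` congruent modulo `n` to `(1, 0)` when `φ = 1 / n`, and to `(0, 1)` when `φ = -θ / n`
(`sq_mul_inhomApproxConst`).

Put `(U, V) = (P + Q, P - Q)`. As `θ = (c + 1) / (c - 1)` with `c = coth (1 / k)`, this is a
question on approximating `c` by `U / V`, and `c` has the continued fraction `[k; 3k, 5k, …]`, whose
partial quotients tend to infinity. Write `D j = (cothNum k j, cothDen k j)` for its convergents,
`s j` for the difference of the two coordinates (`cothDiff`), and `e j` for the absolute value of
the linear form `Q * θ - P` at `D j` (`cothRemainder`). The `e j` are positive since, up to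
elementary factors, they are integrals of `(1 - t ^ 2) ^ j * exp (t / k)`; and
`s (j + 1) * e j + s j * e (j + 1) = 1` while `s j * e j` tends to `0`.

*Lower bound.* If `s j ≤ |U - V| < s (j + 1)`, then writing `(U, V)` in the lattice basis
`D (j + 1), D j` gives `2 * |Q| * |Q * θ - P| ≥ e j * (s (j + 1) - s j)`, which tends to `1`, unless
`(U, V)` is a multiple of `D j`. All partial quotients being divisible by `k`, one coordinate of
each `D j` is divisible by `gcd n k`, whereas both `U` and `V` are congruent to `1` or `-1` modulo
`gcd n k`; so multiples do not occur when `gcd n k ≠ 1` (`eventually_le_abs_mul_abs`).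

*Upper bound.* The recurrence is periodic modulo `2 * n`, hence infinitely often `D (j + 1)` and
`D j` are congruent to the initial vectors `(1, 0)` and `(0, 1)`. For those `j` the vectors
`D (j + 1) + D j` and `D (j + 1) - D j` have the required residues, and their values tend to `1 / 2`
(`exists_abs_mul_abs_le`).
-/

/-! ### Solutions of the recurrence of the continued fraction of `coth (1 / k)` -/

/-- The solution of `w (j + 2) = (2 j + 1) k w (j + 1) + w j` with `w 0 = x` and `w 1 = y`. The
coefficients `k, 3k, 5k, …` are the partial quotients of `coth (1 / k)`. -/
def cothRec {R : Type*} [CommRing R] (k : ℕ) (x y : R) : ℕ → R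
  | 0 => x
  | 1 => y
  | j + 2 => (2 * (j : R) + 1) * (k : R) * cothRec k x y (j + 1) + cothRec k x y j

/-- The numerators `0, 1, k, …` of the convergents of `coth (1 / k)`. The first two belong to the
conventional initial vectors `(0, 1)` and `(1, 0)`, so that the genuine convergents start at index
`2`. -/
def cothNum (k j : ℕ) : ℤ := cothRec k 0 1 j

/-- The denominators `1, 0, 1, …` of the convergents of `coth (1 / k)`, indexed like `cothNum`. -/
def cothDen (k j : ℕ) : ℤ := cothRec k 1 0 j

/-- The difference of numerator and denominator of a convergent of `coth (1 / k)`. Since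
`exp (2 / k) = (coth (1 / k) + 1) / (coth (1 / k) - 1)`, this is twice the denominator of the
corresponding approximation to `exp (2 / k)`. -/
def cothDiff (k j : ℕ) : ℤ := cothNum k j - cothDen k j

lemma cothNum_add_two (k j : ℕ) :
    cothNum k (j + 2) = (2 * (j : ℤ) + 1) * (k : ℤ) * cothNum k (j + 1) + cothNum k j := rfl

lemma cothDen_add_two (k j : ℕ) :
    cothDen k (j + 2) = (2 * (j : ℤ) + 1) * (k : ℤ) * cothDen k (j + 1) + cothDen k j := rfl

lemma cothDiff_add_two (k j : ℕ) :
    cothDiff k (j + 2) = (2 * (j : ℤ) + 1) * (k : ℤ) * cothDiff k (j + 1) + cothDiff k j := by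
  simp only [cothDiff, cothNum_add_two, cothDen_add_two]
  ring

lemma cothNum_mul_cothDen_sub (k j : ℕ) :
    cothNum k (j + 1) * cothDen k j - cothNum k j * cothDen k (j + 1) = (-1) ^ j := by
  induction j with
  | zero => simp [cothNum, cothDen, cothRec]
  | succ j ih =>
    rw [cothNum_add_two, cothDen_add_two, pow_succ, ← ih]
    ring

lemma dvd_cothNum_or_dvd_cothDen {g k : ℕ} (h : g ∣ k) (j : ℕ) :
    (g : ℤ) ∣ cothNum k j ∨ (g : ℤ) ∣ cothDen k j := by
  have hk : (g : ℤ) ∣ (k : ℤ) := Int.natCast_dvd_natCast.mpr h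
  induction j using Nat.twoStepInduction with
  | zero => exact Or.inl (dvd_zero _)
  | one => exact Or.inr (dvd_zero _)
  | more j ih _ =>
    rw [cothNum_add_two, cothDen_add_two]
    exact ih.imp (fun h => dvd_add (Dvd.dvd.mul_right (hk.mul_left _) _) h)
      (fun h => dvd_add (Dvd.dvd.mul_right (hk.mul_left _) _) h)

lemma cothDiff_nonneg_and_lt {k : ℕ} (hk : 1 ≤ k) (j : ℕ) :
    0 ≤ cothDiff k (j + 2) ∧ cothDiff k (j + 2) + 1 ≤ cothDiff k (j + 3) := by
  have hk' : (1 : ℤ) ≤ k := by exact_mod_cast hk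
  induction j with
  | zero =>
    have h0 : cothDiff k 0 = -1 := rfl
    have h1 : cothDiff k 1 = 1 := rfl
    rw [cothDiff_add_two k 1, cothDiff_add_two k 0, h0, h1]
    push_cast
    constructor <;> nlinarith
  | succ j ih =>
    have hs : 1 ≤ cothDiff k (j + 3) := by linarith [ih.1, ih.2]
    have h2 : (2 : ℤ) ≤ (2 * ((j + 2 : ℕ) : ℤ) + 1) * k := by
      push_cast
      nlinarith
    refine ⟨zero_le_one.trans hs, ?_⟩
    have h3 := cothDiff_add_two k (j + 2)
    have h4 := mul_le_mul_of_nonneg_right h2 (zero_le_one.trans hs)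
    change cothDiff k (j + 3) + 1 ≤ cothDiff k (j + 2 + 2)
    change cothDiff k (j + 2 + 2) = _ * cothDiff k (j + 3) + _ at h3
    linarith [ih.1]

lemma cothDiff_nonneg {k : ℕ} (hk : 1 ≤ k) {j : ℕ} (hj : 1 ≤ j) : 0 ≤ cothDiff k j := by
  obtain ⟨i, rfl⟩ := Nat.exists_eq_add_of_le' hj
  cases i with
  | zero => exact zero_le_one
  | succ i => exact (cothDiff_nonneg_and_lt hk i).1

lemma le_cothDiff {k : ℕ} (hk : 1 ≤ k) (j : ℕ) : (j : ℤ) ≤ cothDiff k (j + 2) := by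
  induction j with
  | zero => exact (cothDiff_nonneg_and_lt hk 0).1
  | succ j ih =>
    have := (cothDiff_nonneg_and_lt hk j).2
    push_cast
    linarith

/-- Every large integer lies between two consecutive values of `cothDiff k`. -/
lemma exists_cothDiff_le_lt {k : ℕ} (hk : 1 ≤ k) {J : ℕ} (hJ : 2 ≤ J) {M : ℤ}
    (hM : cothDiff k J ≤ M) :
    ∃ j, J ≤ j ∧ cothDiff k j ≤ M ∧ M < cothDiff k (j + 1) := by
  by_contra! H
  have h : ∀ i, cothDiff k (J + i) ≤ M := by
    intro i
    induction i with
    | zero => exact hM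
    | succ i ih => exact H (J + i) (by omega) ih
  have h1 := h (M.toNat + 1)
  have h2 := le_cothDiff hk (J + (M.toNat + 1) - 2)
  rw [show J + (M.toNat + 1) - 2 + 2 = J + (M.toNat + 1) by omega] at h2
  omega

/-! ### Periodicity of the convergents modulo an integer -/

/-- One step of the recurrence modulo `N`, as a permutation of the finite set of states
`(j, w j, w (j + 1))`. -/
def cothStep (N k : ℕ) : Equiv.Perm (ZMod N × ZMod N × ZMod N) where
  toFun s := (s.1 + 1, s.2.2, (2 * s.1 + 1) * (k : ZMod N) * s.2.2 + s.2.1)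
  invFun s := (s.1 - 1, s.2.2 - (2 * (s.1 - 1) + 1) * (k : ZMod N) * s.2.1, s.2.1)
  left_inv s := by ext <;> simp
  right_inv s := by ext <;> simp

lemma cothStep_pow_apply (N k : ℕ) (x y : ℤ) (j : ℕ) :
    (cothStep N k ^ j) (0, (x : ZMod N), (y : ZMod N)) =
      ((j : ZMod N), ((cothRec k x y j : ℤ) : ZMod N),
        ((cothRec k x y (j + 1) : ℤ) : ZMod N)) := by
  induction j with
  | zero => simp [cothRec]
  | succ j ih =>
    rw [pow_succ', Equiv.Perm.mul_apply, ih]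
    simp [cothStep, cothRec]

/-- Arbitrarily late, two consecutive convergents are congruent to the initial vectors. -/
lemma exists_convergents_modEq (k : ℕ) {N : ℕ} (hN : 0 < N) (J : ℕ) :
    ∃ j, J ≤ j ∧ (N : ℤ) ∣ cothNum k j ∧ (N : ℤ) ∣ cothNum k (j + 1) - 1 ∧
      (N : ℤ) ∣ cothDen k j - 1 ∧ (N : ℤ) ∣ cothDen k (j + 1) := by
  have : NeZero N := ⟨hN.ne'⟩
  have hr : 0 < orderOf (cothStep N k) := orderOf_pos _
  have key : ∀ x y : ℤ,
      ((cothRec k x y (orderOf (cothStep N k) * J) : ℤ) : ZMod N) = x ∧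
      ((cothRec k x y (orderOf (cothStep N k) * J + 1) : ℤ) : ZMod N) = y := by
    intro x y
    have h := cothStep_pow_apply N k x y (orderOf (cothStep N k) * J)
    rw [pow_mul, pow_orderOf_eq_one, one_pow, Equiv.Perm.one_apply, Prod.mk.injEq,
      Prod.mk.injEq] at h
    exact ⟨h.2.1.symm, h.2.2.symm⟩
  refine ⟨orderOf (cothStep N k) * J, Nat.le_mul_of_pos_left J hr, ?_, ?_, ?_, ?_⟩ <;>
    rw [← ZMod.intCast_zmod_eq_zero_iff_dvd] <;> push_cast
  · simpa [cothNum] using (key 0 1).1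
  · simpa [cothNum, sub_eq_zero] using (key 0 1).2
  · simpa [cothDen, sub_eq_zero] using (key 1 0).1
  · simpa [cothDen] using (key 1 0).2

/-! ### The remainders, as integrals -/

/-- The integral of `(1 - t ^ 2) ^ j * exp (x * t)` over `[-1, 1]`, up to elementary factors a
modified spherical Bessel function of `x`. -/
noncomputable def besselIntegral (x : ℝ) (j : ℕ) : ℝ :=
  ∫ t in (-1 : ℝ)..1, (1 - t ^ 2) ^ j * Real.exp (x * t)

lemma besselIntegral_pos (x : ℝ) (j : ℕ) : 0 < besselIntegral x j := by
  refine intervalIntegral.intervalIntegral_pos_of_pos_on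
    (Continuous.intervalIntegrable (by fun_prop) _ _) (fun t ht => ?_) (by norm_num)
  have : 0 < 1 - t ^ 2 := by nlinarith [ht.1, ht.2]
  positivity

lemma mul_besselIntegral_zero (x : ℝ) :
    x * besselIntegral x 0 = Real.exp x - Real.exp (-x) := by
  have h : ∀ t ∈ Set.uIcc (-1 : ℝ) 1,
      HasDerivAt (fun t => Real.exp (x * t)) (Real.exp (x * t) * (x * 1)) t :=
    fun t _ => ((hasDerivAt_id t).const_mul x).exp
  have := intervalIntegral.integral_eq_sub_of_hasDerivAt h
    (Continuous.intervalIntegrable (by fun_prop) _ _)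
  simp only [mul_one, mul_neg, intervalIntegral.integral_mul_const] at this
  simp only [besselIntegral, pow_zero, one_mul, ← this]
  ring

lemma besselIntegral_one (x : ℝ) :
    x ^ 2 * besselIntegral x 1 + 2 * besselIntegral x 0 = 2 * (Real.exp x + Real.exp (-x)) := by
  have h : ∀ t ∈ Set.uIcc (-1 : ℝ) 1,
      HasDerivAt (fun t => Real.exp (x * t) * (x * (1 - t ^ 2) + 2 * t))
        (x ^ 2 * ((1 - t ^ 2) ^ 1 * Real.exp (x * t)) +
          2 * ((1 - t ^ 2) ^ 0 * Real.exp (x * t))) t := by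
    intro t _
    have h1 : HasDerivAt (fun t => Real.exp (x * t)) (Real.exp (x * t) * (x * 1)) t :=
      ((hasDerivAt_id t).const_mul x).exp
    have h2 : HasDerivAt (fun t : ℝ => 1 - t ^ 2) (-(2 * t)) t := by
      simpa using (hasDerivAt_pow 2 t).const_sub 1
    refine (h1.mul ((h2.const_mul x).add ((hasDerivAt_id' t).const_mul 2))).congr_deriv ?_
    simp only [Pi.add_apply]
    ring
  have := intervalIntegral.integral_eq_sub_of_hasDerivAt h
    (Continuous.intervalIntegrable (by fun_prop) _ _)
  rw [intervalIntegral.integral_add (Continuous.intervalIntegrable (by fun_prop) _ _)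
    (Continuous.intervalIntegrable (by fun_prop) _ _), intervalIntegral.integral_const_mul,
    intervalIntegral.integral_const_mul] at this
  rw [besselIntegral, besselIntegral, this]
  norm_num
  ring

/-- Integration by parts, twice: the boundary terms vanish. -/
lemma besselIntegral_add_two (x : ℝ) (j : ℕ) :
    x ^ 2 * besselIntegral x (j + 2) + 2 * (j + 2) * (2 * j + 3) * besselIntegral x (j + 1) =
      4 * (j + 1) * (j + 2) * besselIntegral x j := by
  have h : ∀ t ∈ Set.uIcc (-1 : ℝ) 1,
      HasDerivAt (fun t => Real.exp (x * t) *
          (x * (1 - t ^ 2) ^ (j + 2) + 2 * ((j : ℝ) + 2) * (t * (1 - t ^ 2) ^ (j + 1))))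
        (x ^ 2 * ((1 - t ^ 2) ^ (j + 2) * Real.exp (x * t)) +
          2 * (j + 2) * (2 * j + 3) * ((1 - t ^ 2) ^ (j + 1) * Real.exp (x * t)) -
          4 * (j + 1) * (j + 2) * ((1 - t ^ 2) ^ j * Real.exp (x * t))) t := by
    intro t _
    have h1 : HasDerivAt (fun t => Real.exp (x * t)) (Real.exp (x * t) * (x * 1)) t :=
      ((hasDerivAt_id t).const_mul x).exp
    have h2 : HasDerivAt (fun t : ℝ => 1 - t ^ 2) (-(2 * t)) t := by
      simpa using (hasDerivAt_pow 2 t).const_sub 1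
    refine (h1.mul (((h2.fun_pow (j + 2)).const_mul x).add
      (((hasDerivAt_id' t).fun_mul (h2.fun_pow (j + 1))).const_mul
        (2 * ((j : ℝ) + 2))))).congr_deriv ?_
    simp only [Pi.add_apply, Nat.add_sub_cancel, Nat.add_succ_sub_one]
    push_cast
    ring
  have := intervalIntegral.integral_eq_sub_of_hasDerivAt h
    (Continuous.intervalIntegrable (by fun_prop) _ _)
  rw [intervalIntegral.integral_sub (Continuous.intervalIntegrable (by fun_prop) _ _)
    (Continuous.intervalIntegrable (by fun_prop) _ _),
    intervalIntegral.integral_add (Continuous.intervalIntegrable (by fun_prop) _ _)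
    (Continuous.intervalIntegrable (by fun_prop) _ _), intervalIntegral.integral_const_mul,
    intervalIntegral.integral_const_mul, intervalIntegral.integral_const_mul] at this
  rw [← sub_eq_zero]
  simp only [besselIntegral]
  rw [this]
  norm_num

/-- The absolute value of `Q * exp (2 / k) - P` for the approximation `P / Q` to `exp (2 / k)`
that comes from the `j`-th convergent of `coth (1 / k)`, namely for `P` and `Q` half the sum and
half the difference of its numerator and denominator. -/
noncomputable def cothRemainder (k : ℕ) : ℕ → ℝ
  | 0 => (Real.exp (2 / k) + 1) / 2
  | j + 1 => Real.exp (1 / k) / 2 * ((1 / k) ^ (j + 1) / (2 ^ j * (j.factorial : ℝ))) *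
      besselIntegral (1 / k) j

lemma cothRemainder_pos {k : ℕ} (hk : 1 ≤ k) (j : ℕ) : 0 < cothRemainder k j := by
  have hk' : (0 : ℝ) < k := by exact_mod_cast hk
  cases j with
  | zero =>
    simp only [cothRemainder]
    positivity
  | succ j =>
    have := besselIntegral_pos (1 / k) j
    simp only [cothRemainder]
    positivity

lemma exp_two_div (k : ℕ) : Real.exp (2 / k) = Real.exp (1 / k) * Real.exp (1 / k) := by
  rw [← Real.exp_add]
  ring_nf

lemma cothRemainder_one (k : ℕ) : cothRemainder k 1 = (Real.exp (2 / k) - 1) / 2 := by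
  have h := mul_besselIntegral_zero (1 / k)
  have h2 : Real.exp (1 / k) * Real.exp (-(1 / k)) = 1 := by rw [← Real.exp_add]; simp
  simp only [cothRemainder, exp_two_div]
  simp only [zero_add, pow_one, pow_zero, Nat.factorial_zero, Nat.cast_one, mul_one, div_one]
  linear_combination (Real.exp (1 / k) / 2) * h - h2 / 2

lemma cothRemainder_recurrence {k : ℕ} (hk : 1 ≤ k) (j : ℕ) :
    cothRemainder k j = (2 * j + 1) * k * cothRemainder k (j + 1) + cothRemainder k (j + 2) := by
  have hk' : (k : ℝ) ≠ 0 := by positivity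
  have hkx : (k : ℝ) * (1 / k) = 1 := by field_simp
  cases j with
  | zero =>
    have h := besselIntegral_one (1 / k)
    have h0 := mul_besselIntegral_zero (1 / k)
    have h2 : Real.exp (1 / k) * Real.exp (-(1 / k)) = 1 := by rw [← Real.exp_add]; simp
    rw [zero_add, zero_add, cothRemainder_one]
    simp only [cothRemainder, exp_two_div]
    have hB : besselIntegral (1 / k) 0 = k * (Real.exp (1 / k) - Real.exp (-(1 / k))) := by
      linear_combination (k : ℝ) * h0 - besselIntegral (1 / k) 0 * hkx
    rw [hB] at h
    norm_num at h h2 ⊢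
    linear_combination (-Real.exp (k : ℝ)⁻¹ / 4) * h - (1 + k) / 2 * h2
  | succ j =>
    have h := besselIntegral_add_two (1 / k) j
    have hj : (j.factorial : ℝ) ≠ 0 := by positivity
    have hB : besselIntegral (1 / k) (j + 2) = (k : ℝ) ^ 2 * (4 * (j + 1) * (j + 2) *
        besselIntegral (1 / k) j -
          2 * (j + 2) * (2 * j + 3) * besselIntegral (1 / k) (j + 1)) := by
      linear_combination (k : ℝ) ^ 2 * h -
        besselIntegral (1 / k) (j + 2) * (k * (1 / k) + 1) * hkx
    simp only [cothRemainder, Nat.factorial_succ, hB]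
    push_cast
    generalize besselIntegral (1 / k) j = a
    generalize besselIntegral (1 / k) (j + 1) = b
    generalize Real.exp (1 / k) = c
    simp only [one_div_pow]
    field_simp
    ring

lemma cothNum_mul_sub_cothDen_mul {k : ℕ} (hk : 1 ≤ k) (j : ℕ) :
    cothNum k j * cothRemainder k 1 - cothDen k j * cothRemainder k 0 =
      -(-1) ^ j * cothRemainder k j := by
  induction j using Nat.twoStepInduction with
  | zero => simp [cothNum, cothDen, cothRec]
  | one => simp [cothNum, cothDen, cothRec]
  | more j ih ih' =>
    rw [cothNum_add_two, cothDen_add_two]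
    push_cast
    rw [pow_succ] at ih'
    rw [pow_succ, pow_succ]
    linear_combination (2 * (j : ℝ) + 1) * k * ih' + ih -
      (-1) ^ j * cothRemainder_recurrence hk j

lemma cothDiff_mul_cothRemainder_add {k : ℕ} (hk : 1 ≤ k) (j : ℕ) :
    cothDiff k (j + 1) * cothRemainder k j + cothDiff k j * cothRemainder k (j + 1) = 1 := by
  induction j with
  | zero =>
    rw [zero_add, cothRemainder_one]
    simp only [cothDiff, cothNum, cothDen, cothRec, cothRemainder]
    push_cast
    ring
  | succ j ih =>
    rw [cothDiff_add_two]
    push_cast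
    rw [cothRemainder_recurrence hk j] at ih
    linarith

/-- The products `cothDiff k j * cothRemainder k j` tend to `0`, because the partial quotients of
`coth (1 / k)` tend to infinity. -/
lemma mul_cothDiff_mul_cothRemainder_le {k : ℕ} (hk : 1 ≤ k) {j : ℕ} (hj : 1 ≤ j) :
    (2 * j + 1) * (cothDiff k (j + 1) * cothRemainder k (j + 1)) ≤ 1 := by
  have hk' : (1 : ℝ) ≤ k := by exact_mod_cast hk
  have hs : (0 : ℝ) ≤ cothDiff k j := by exact_mod_cast cothDiff_nonneg hk hj
  have hs' : (0 : ℝ) ≤ cothDiff k (j + 1) := by exact_mod_cast cothDiff_nonneg hk (by omega)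
  have h0 := cothRemainder_pos hk (j + 1)
  have h1 := cothRemainder_pos hk (j + 2)
  have h2 := cothRemainder_recurrence hk j
  have h3 := cothDiff_mul_cothRemainder_add hk j
  have h4 : (2 * j + 1) * cothRemainder k (j + 1) ≤ cothRemainder k j := by
    have : (2 * j + 1) * cothRemainder k (j + 1) * 1 ≤ (2 * j + 1) * cothRemainder k (j + 1) * k :=
      mul_le_mul_of_nonneg_left hk' (by positivity)
    linarith
  have h5 := mul_le_mul_of_nonneg_left h4 hs'
  have h6 := mul_nonneg hs h0.le
  linarith

lemma exists_cothDiff_mul_cothRemainder_le {k : ℕ} (hk : 1 ≤ k) {ε : ℝ} (hε : 0 < ε) :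
    ∃ J, ∀ j, J ≤ j → cothDiff k j * cothRemainder k j ≤ ε := by
  obtain ⟨J, hJ⟩ := exists_nat_gt (1 / ε)
  refine ⟨J + 2, fun j hj => ?_⟩
  obtain ⟨i, rfl⟩ : ∃ i, j = i + 1 := ⟨j - 1, by omega⟩
  have h := mul_cothDiff_mul_cothRemainder_le hk (show 1 ≤ i by omega)
  have hs : (0 : ℝ) ≤ cothDiff k (i + 1) := by exact_mod_cast cothDiff_nonneg hk (by omega)
  have h0 := mul_nonneg hs (cothRemainder_pos hk (i + 1)).le
  have hiJ : (J : ℝ) ≤ i := by exact_mod_cast (show J ≤ i by omega)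
  rw [div_lt_iff₀ hε] at hJ
  by_contra! hlt
  nlinarith

lemma cothRemainder_succ_le {k : ℕ} (hk : 1 ≤ k) (j : ℕ) :
    cothRemainder k (j + 1) ≤ cothRemainder k j := by
  have hk' : (1 : ℝ) ≤ k := by exact_mod_cast hk
  have h4 : (1 : ℝ) ≤ (2 * (j : ℝ) + 1) * k := by
    have : (0 : ℝ) ≤ (j : ℝ) := by positivity
    nlinarith
  have h5 := mul_le_mul_of_nonneg_right h4 (cothRemainder_pos hk (j + 1)).le
  linarith [cothRemainder_recurrence hk j, cothRemainder_pos hk (j + 2)]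

/-! ### Approximations to `exp (2 / k)` -/

/-- The upper bound on `|a * s' + b * s|` forces `a` and `b` to have opposite signs, so that the
second factor is at least `|b| * e`. It remains that `|b| * |a * s' + b * s| ≥ s' - s`, where the
first factor is at least both `s` and `s' - |b| * s`. -/
lemma le_abs_mul_abs {a b s s' : ℤ} {e e' : ℝ} (he : 0 < e) (he' : 0 < e') (hs : 0 ≤ s)
    (ha : a ≠ 0) (h1 : s ≤ |a * s' + b * s|) (h2 : |a * s' + b * s| < s') :
    e * (s' - s) ≤ ((|a * s' + b * s| : ℤ) : ℝ) * |a * e' - b * e| := by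
  wlog hpos : 0 < a generalizing a b
  · have := this (a := -a) (b := -b) (neg_ne_zero.mpr ha)
      (by rwa [show -a * s' + -b * s = -(a * s' + b * s) by ring, abs_neg])
      (by rwa [show -a * s' + -b * s = -(a * s' + b * s) by ring, abs_neg]) (by omega)
    rw [show -a * s' + -b * s = -(a * s' + b * s) by ring, abs_neg] at this
    push_cast at this ⊢
    rwa [show -(a : ℝ) * e' - -(b : ℝ) * e = -(a * e' - b * e) by ring, abs_neg] at this
  have hs' : 0 < s' := (abs_nonneg _).trans_lt h2
  have has : s' ≤ a * s' := le_mul_of_one_le_left hs'.le hpos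
  have hle := le_abs_self (a * s' + b * s)
  have hb : b < 0 := by
    by_contra! hb
    have := mul_nonneg hb hs
    linarith
  obtain ⟨c, rfl⟩ : ∃ c, b = -c := ⟨-b, by ring⟩
  have hc : 1 ≤ c := by omega
  set m := |a * s' + -c * s|
  have hm : s' - c * s ≤ m := by linarith
  have key : s' - s ≤ m * c := by
    rcases le_total (s' - c * s) s with h | h
    · nlinarith
    · nlinarith
  have hcR : (1 : ℝ) ≤ c := by exact_mod_cast hc
  have haR : (0 : ℝ) < a := by exact_mod_cast hpos
  have keyR : (s' : ℝ) - s ≤ m * c := by exact_mod_cast key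
  have hmR : (0 : ℝ) ≤ m := by exact_mod_cast abs_nonneg _
  have hl : c * e ≤ |a * e' - ((-c : ℤ) : ℝ) * e| := by
    refine le_trans ?_ (le_abs_self _)
    push_cast
    have := mul_pos haR he'
    linarith
  calc e * (s' - s) ≤ e * (m * c) := mul_le_mul_of_nonneg_left keyR he.le
    _ = m * (c * e) := by ring
    _ ≤ _ := mul_le_mul_of_nonneg_left hl hmR

/-- The vector `(U, V)` is written in the lattice basis given by two consecutive convergents. -/
lemma le_abs_sub_mul_abs {k : ℕ} (hk : 1 ≤ k) {j : ℕ} (hj : 1 ≤ j) {U V : ℤ}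
    (h1 : cothDiff k j ≤ |U - V|) (h2 : |U - V| < cothDiff k (j + 1))
    (hUV : ∀ b : ℤ, ¬(U = b * cothNum k j ∧ V = b * cothDen k j)) :
    cothRemainder k j * (cothDiff k (j + 1) - cothDiff k j) ≤
      ((|U - V| : ℤ) : ℝ) * |U * cothRemainder k 1 - V * cothRemainder k 0| := by
  have hdet := cothNum_mul_cothDen_sub k j
  have hsq : ((-1 : ℤ) ^ j) * (-1) ^ j = 1 := by rw [← mul_pow]; simp
  obtain ⟨a, b, hU, hV⟩ : ∃ a b : ℤ, U = a * cothNum k (j + 1) + b * cothNum k j ∧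
      V = a * cothDen k (j + 1) + b * cothDen k j := by
    refine ⟨(-1) ^ j * (U * cothDen k j - V * cothNum k j),
      (-1) ^ j * (V * cothNum k (j + 1) - U * cothDen k (j + 1)), ?_, ?_⟩
    · linear_combination (-U) * hsq - (-1) ^ j * U * hdet
    · linear_combination (-V) * hsq - (-1) ^ j * V * hdet
  have ha : a ≠ 0 := by
    rintro rfl
    exact hUV b ⟨by simpa using hU, by simpa using hV⟩
  have hμ : U - V = a * cothDiff k (j + 1) + b * cothDiff k j := by
    rw [hU, hV, cothDiff, cothDiff]
    ring
  have hl : |U * cothRemainder k 1 - V * cothRemainder k 0| =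
      |a * cothRemainder k (j + 1) - b * cothRemainder k j| := by
    have e1 := cothNum_mul_sub_cothDen_mul hk j
    have e2 := cothNum_mul_sub_cothDen_mul hk (j + 1)
    have : U * cothRemainder k 1 - V * cothRemainder k 0 =
        (-1) ^ j * (a * cothRemainder k (j + 1) - b * cothRemainder k j) := by
      rw [hU, hV]
      push_cast
      rw [pow_succ] at e2
      linear_combination (a : ℝ) * e2 + b * e1
    rw [this, abs_mul, abs_neg_one_pow, one_mul]
  rw [hμ] at h1 h2 ⊢
  rw [hl]
  exact le_abs_mul_abs (cothRemainder_pos hk j) (cothRemainder_pos hk (j + 1))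
    (cothDiff_nonneg hk hj) ha h1 h2

lemma mul_exp_sub (k : ℕ) (P Q : ℤ) :
    Q * Real.exp (2 / k) - P =
      ((P + Q : ℤ) : ℝ) * cothRemainder k 1 - ((P - Q : ℤ) : ℝ) * cothRemainder k 0 := by
  rw [cothRemainder_one, cothRemainder]
  push_cast
  ring

/-- Apart from the pairs `(P, Q)` that come from multiples of convergents of `coth (1 / k)`, which
the divisibility hypotheses exclude, the values `|Q| * |Q * exp (2 / k) - P|` accumulate only at
`1 / 2` and above. The factor `|Q| - 1` in place of `|Q|` leaves room for replacing `Q` by a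
neighbouring integer. -/
lemma eventually_le_abs_mul_abs {k g : ℕ} (hk : 1 ≤ k) (hg : g ∣ k) {ε : ℝ} (hε : 0 < ε) :
    ∃ N : ℤ, ∀ P Q : ℤ, N ≤ |Q| → ¬ (g : ℤ) ∣ P + Q → ¬ (g : ℤ) ∣ P - Q →
      1 / 2 - ε ≤ ((|Q| : ℤ) - 1 : ℝ) * |Q * Real.exp (2 / k) - P| := by
  obtain ⟨J, hJ⟩ := exists_cothDiff_mul_cothRemainder_le hk (half_pos hε)
  obtain ⟨M, hM⟩ := exists_nat_gt (1 / ε)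
  rw [div_lt_iff₀ hε] at hM
  refine ⟨max (cothDiff k (J + 2)) M, fun P Q hQ hP1 hP2 => ?_⟩
  have hμ : |(P + Q) - (P - Q)| = 2 * |Q| := by
    rw [show (P + Q) - (P - Q) = 2 * Q by ring, abs_mul]
    rfl
  have hMQ : (M : ℝ) ≤ ((|Q| : ℤ) : ℝ) := by exact_mod_cast (le_max_right _ _).trans hQ
  obtain ⟨j, hjJ, hj1, hj2⟩ := exists_cothDiff_le_lt hk (show 2 ≤ J + 2 by omega)
    (show cothDiff k (J + 2) ≤ |(P + Q) - (P - Q)| by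
      rw [hμ]
      linarith [(le_max_left (cothDiff k (J + 2)) (M : ℤ)).trans hQ, abs_nonneg Q])
  have h := le_abs_sub_mul_abs hk (by omega) hj1 hj2 (by
    rintro b ⟨hU, hV⟩
    rcases dvd_cothNum_or_dvd_cothDen hg j with hd | hd
    · exact hP1 (hU ▸ hd.mul_left b)
    · exact hP2 (hV ▸ hd.mul_left b))
  rw [← mul_exp_sub, hμ, Int.cast_mul] at h
  have hse := hJ j (by omega)
  have hid := cothDiff_mul_cothRemainder_add hk j
  have hs : (0 : ℝ) ≤ cothDiff k j := by exact_mod_cast cothDiff_nonneg hk (by omega)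
  have hse' := mul_le_mul_of_nonneg_left (cothRemainder_succ_le hk j) hs
  have hD : 0 ≤ |Q * Real.exp (2 / k) - P| := abs_nonneg _
  generalize |Q * Real.exp (2 / k) - P| = D at *
  generalize ((|Q| : ℤ) : ℝ) = q at *
  have hF : 1 - ε ≤ 2 * (q * D) := by
    norm_num at h
    linarith
  -- If `D` is not small then `(q - 1) * D` is large simply because `q` is.
  rcases le_total D (ε / 2) with hDε | hDε
  · linarith
  · have hq : 1 ≤ q * ε := hM.le.trans (mul_le_mul_of_nonneg_right hMQ hε.le)
    have hM1 : (1 : ℝ) ≤ M := by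
      have : M ≠ 0 := by
        rintro rfl
        norm_num at hM
      exact_mod_cast Nat.one_le_iff_ne_zero.mpr this
    nlinarith

/-- The sums and differences of consecutive convergents realize the value `1 / 2`, here as an
upper bound that holds even with `|Q| + 1` in place of `|Q|`. -/
lemma exists_abs_mul_abs_le {k N : ℕ} (hk : 1 ≤ k) (hN : 0 < N) {σ : ℤ} (hσ : |σ| = 1) {ε : ℝ}
    (hε : 0 < ε) (M : ℕ) :
    ∃ P Q : ℤ, (M : ℤ) ≤ Q ∧ ((2 * N : ℕ) : ℤ) ∣ P + Q - 1 ∧ ((2 * N : ℕ) : ℤ) ∣ P - Q - σ ∧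
      (|(Q : ℝ)| + 1) * |Q * Real.exp (2 / k) - P| ≤ 1 / 2 + ε := by
  obtain ⟨J, hJ⟩ := exists_cothDiff_mul_cothRemainder_le hk (show 0 < ε / 3 by positivity)
  obtain ⟨j, hj, d1, d2, d3, d4⟩ :=
    exists_convergents_modEq k (show 0 < 2 * N by omega) (J + M + 3)
  obtain ⟨i, rfl⟩ : ∃ i, j = i + 1 := ⟨j - 1, by omega⟩
  have hσ' : σ = 1 ∨ σ = -1 := eq_or_eq_neg_of_abs_eq hσ
  have dU : ((2 * N : ℕ) : ℤ) ∣ cothNum k (i + 2) + σ * cothNum k (i + 1) - 1 := by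
    rw [add_sub_right_comm]
    exact dvd_add d2 (d1.mul_left σ)
  have dV : ((2 * N : ℕ) : ℤ) ∣ cothDen k (i + 2) + σ * cothDen k (i + 1) - σ := by
    rw [show cothDen k (i + 2) + σ * cothDen k (i + 1) - σ =
      cothDen k (i + 2) + σ * (cothDen k (i + 1) - 1) by ring]
    exact dvd_add d4 (d3.mul_left σ)
  have two_dvd : (2 : ℤ) ∣ ((2 * N : ℕ) : ℤ) := ⟨N, by push_cast; ring⟩
  obtain ⟨x, hx⟩ := two_dvd.trans dU
  obtain ⟨y, hy⟩ := two_dvd.trans dV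
  obtain ⟨P, Q, hPQ, hPQ'⟩ : ∃ P Q : ℤ, P + Q = cothNum k (i + 2) + σ * cothNum k (i + 1) ∧
      P - Q = cothDen k (i + 2) + σ * cothDen k (i + 1) := by
    rcases hσ' with rfl | rfl
    · exact ⟨x + y + 1, x - y, by linarith, by linarith⟩
    · exact ⟨x + y, x - y + 1, by linarith, by linarith⟩
  have hQ : 2 * Q = cothDiff k (i + 2) + σ * cothDiff k (i + 1) := by
    simp only [cothDiff]
    linarith
  have hs : (M : ℤ) + 1 ≤ cothDiff k (i + 1) := by
    have := le_cothDiff hk (i - 1)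
    rw [show i - 1 + 2 = i + 1 by omega] at this
    omega
  have hs3 : 3 * cothDiff k (i + 1) ≤ cothDiff k (i + 2) := by
    rw [cothDiff_add_two]
    have h0 := cothDiff_nonneg hk (show 1 ≤ i by omega)
    have hk' : (1 : ℤ) ≤ k := by exact_mod_cast hk
    have hi : (1 : ℤ) ≤ i := by omega
    have : (3 : ℤ) ≤ (2 * (i : ℤ) + 1) * k := by nlinarith
    nlinarith
  have hQM : (M : ℤ) + 1 ≤ Q := by rcases hσ' with rfl | rfl <;> linarith
  refine ⟨P, Q, by linarith, hPQ ▸ dU, hPQ' ▸ dV, ?_⟩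
  have hid := cothDiff_mul_cothRemainder_add hk (i + 1)
  have hse := hJ (i + 1) (by omega)
  have hse' := hJ (i + 2) (by omega)
  have he := cothRemainder_pos hk (i + 1)
  have he' := cothRemainder_pos hk (i + 2)
  have hee := cothRemainder_succ_le hk (i + 1)
  have hs1 : (1 : ℝ) ≤ cothDiff k (i + 1) := by exact_mod_cast (by linarith : (1 : ℤ) ≤ _)
  have hQ0 : (0 : ℝ) ≤ Q := by exact_mod_cast (by linarith : (0 : ℤ) ≤ Q)
  have hσR : |(σ : ℝ)| = 1 := by exact_mod_cast congrArg (Int.cast : ℤ → ℝ) hσ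
  have hl : |Q * Real.exp (2 / k) - P| ≤ cothRemainder k (i + 1) + cothRemainder k (i + 2) := by
    have e1 := cothNum_mul_sub_cothDen_mul hk (i + 1)
    have e2 := cothNum_mul_sub_cothDen_mul hk (i + 2)
    have : Q * Real.exp (2 / k) - P =
        (-1) ^ i * (σ * cothRemainder k (i + 1) - cothRemainder k (i + 2)) := by
      rw [mul_exp_sub, hPQ, hPQ']
      push_cast
      rw [pow_succ] at e1
      rw [pow_succ, pow_succ] at e2
      linear_combination e2 + (σ : ℝ) * e1
    rw [this, abs_mul, abs_neg_one_pow, one_mul]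
    refine (abs_sub _ _).trans ?_
    rw [abs_mul, hσR, one_mul, abs_of_pos he, abs_of_pos he']
  have hQle : (Q : ℝ) ≤ (cothDiff k (i + 2) + cothDiff k (i + 1)) / 2 := by
    have : 2 * Q ≤ cothDiff k (i + 2) + cothDiff k (i + 1) := by
      rcases hσ' with rfl | rfl <;> linarith
    have : (2 : ℝ) * Q ≤ cothDiff k (i + 2) + cothDiff k (i + 1) := by exact_mod_cast this
    linarith
  have heε : cothRemainder k (i + 1) ≤ ε / 3 := (le_mul_of_one_le_left he.le hs1).trans hse
  rw [abs_of_nonneg hQ0]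
  calc _ ≤ ((cothDiff k (i + 2) + cothDiff k (i + 1)) / 2 + 1 : ℝ) *
        (cothRemainder k (i + 1) + cothRemainder k (i + 2)) :=
        mul_le_mul (by linarith) hl (abs_nonneg _) (by linarith)
    _ = ((cothDiff k (i + 2) * cothRemainder k (i + 1) +
          cothDiff k (i + 1) * cothRemainder k (i + 2)) +
          cothDiff k (i + 1) * cothRemainder k (i + 1) +
          cothDiff k (i + 2) * cothRemainder k (i + 2)) / 2 +
          (cothRemainder k (i + 1) + cothRemainder k (i + 2)) := by ring
    _ ≤ 1 / 2 + ε := by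
      rw [show i + 1 + 1 = i + 2 from rfl] at hid hee
      linarith

/-! ### The lower limits -/

lemma eventually_comap_abs_atTop {p : ℤ → Prop} (N : ℤ) (h : ∀ q : ℤ, N ≤ |q| → p q) :
    ∀ᶠ q in comap (fun q : ℤ => |q|) atTop, p q :=
  mem_of_superset (preimage_mem_comap (mem_atTop N)) h

lemma frequently_comap_abs_atTop {p : ℤ → Prop} (h : ∀ N : ℕ, ∃ q : ℤ, N ≤ |q| ∧ p q) :
    ∃ᶠ q in comap (fun q : ℤ => |q|) atTop, p q := by
  intro H
  obtain ⟨t, ht, hsub⟩ := mem_comap.mp H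
  obtain ⟨N, hN⟩ := mem_atTop_sets.mp ht
  obtain ⟨q, hq, hpq⟩ := h N.toNat
  exact hsub (hN _ ((Int.self_le_toNat N).trans hq)) hpq

lemma liminf_ofReal_eq {ι : Type*} {l : Filter ι} {f : ι → ℝ} {c : ℝ} (hc : 0 ≤ c)
    (h1 : ∀ ε > 0, ∀ᶠ i in l, c - ε ≤ f i) (h2 : ∀ ε > 0, ∃ᶠ i in l, f i ≤ c + ε) :
    liminf (fun i => ENNReal.ofReal (f i)) l = ENNReal.ofReal c := by
  apply le_antisymm
  · refine ENNReal.le_of_forall_pos_le_add fun ε hε _ => ?_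
    have hε' : (0 : ℝ) < ε := hε
    refine liminf_le_of_frequently_le' ((h2 ε hε').mono fun i hi => ?_)
    refine (ENNReal.ofReal_le_ofReal hi).trans ?_
    rw [ENNReal.ofReal_add hc hε'.le, ENNReal.ofReal_coe_nnreal]
  · refine ENNReal.le_of_forall_pos_le_add fun ε hε _ => ?_
    have hε' : (0 : ℝ) < ε := hε
    rw [← ENNReal.ofReal_coe_nnreal (p := ε), ← tsub_le_iff_right,
      ← ENNReal.ofReal_sub _ hε'.le]
    exact le_liminf_of_le (by isBoundedDefault)
      ((h1 ε hε').mono fun i hi => ENNReal.ofReal_le_ofReal hi)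

lemma distNearestInt_le (x : ℝ) (p : ℤ) : distNearestInt x ≤ |x - p| := round_le x p

/-- Multiplying numerator and denominator by `n` turns the inhomogeneous approximation of
`(r - t * θ) / n` into the homogeneous approximation of `θ` by pairs `(P, Q)` congruent to
`(r, t)` modulo `n`. Here `|n * q|` differs from `|Q|` by at most `1`. -/
lemma sq_mul_inhomApproxConst {n : ℕ} (hn : 2 ≤ n) {θ φ : ℝ} {r t : ℤ} (ht : |t| ≤ 1)
    (hφ : n * φ = r - t * θ)
    (h1 : ∀ ε > 0, ∃ N : ℤ, ∀ P Q : ℤ, N ≤ |Q| → (n : ℤ) ∣ P - r → (n : ℤ) ∣ Q - t →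
      1 / 2 - ε ≤ ((|Q| : ℤ) - 1 : ℝ) * |Q * θ - P|)
    (h2 : ∀ ε > 0, ∀ M : ℕ, ∃ P Q : ℤ, (M : ℤ) ≤ Q ∧ (n : ℤ) ∣ P - r ∧ (n : ℤ) ∣ Q - t ∧
      (|(Q : ℝ)| + 1) * |Q * θ - P| ≤ 1 / 2 + ε) :
    (n : ℝ≥0∞) ^ 2 * inhomApproxConst θ φ = 1 / 2 := by
  have hnR : (0 : ℝ) < n := by positivity
  have hnZ : (2 : ℤ) ≤ n := by exact_mod_cast hn
  have ht1 := abs_le.mp ht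
  -- the identity behind the substitution `P = n * p + r`, `Q = n * q + t`
  have key : ∀ q p : ℤ, |(q : ℝ)| * |q * θ - φ - p| =
      |(n * q : ℝ)| * |((n * q + t : ℤ) : ℝ) * θ - (n * p + r : ℤ)| / n ^ 2 := by
    intro q p
    have : ((n * q + t : ℤ) : ℝ) * θ - (n * p + r : ℤ) = n * (q * θ - φ - p) := by
      push_cast
      linear_combination hφ
    rw [this, abs_mul, abs_mul, abs_of_pos hnR]
    field_simp
  have hc : inhomApproxConst θ φ = ENNReal.ofReal (1 / 2 / n ^ 2) := by
    refine liminf_ofReal_eq (by positivity) (fun ε hε => ?_) (fun ε hε => ?_)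
    · obtain ⟨N, hN⟩ := h1 (ε * n ^ 2) (by positivity)
      refine eventually_comap_abs_atTop (|N| + 1) fun q hq => ?_
      rw [distNearestInt, key]
      have hle : |n * q + t| - 1 ≤ |n * q| := by
        have := abs_add_le (n * q) t
        linarith
      have hge : |q| ≤ |n * q + t| + 1 := by
        have h3 := abs_sub (n * q + t) t
        rw [add_sub_cancel_right, abs_mul, Nat.abs_cast] at h3
        nlinarith [abs_nonneg q]
      have hb := hN (n * round (q * θ - φ) + r) (n * q + t)
        (by linarith [le_abs_self N]) (by simp) (by simp)
      have hleR : ((|n * q + t| : ℤ) : ℝ) - 1 ≤ |(n * q : ℝ)| := by exact_mod_cast hle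
      have hb' := hb.trans (mul_le_mul_of_nonneg_right hleR (abs_nonneg _))
      rw [le_div_iff₀ (by positivity)]
      calc _ = 1 / 2 - ε * (n : ℝ) ^ 2 := by field_simp
        _ ≤ _ := hb'
    · refine frequently_comap_abs_atTop fun M => ?_
      obtain ⟨P, Q, hQM, ⟨p, hp⟩, ⟨q, hq⟩, hb⟩ := h2 (ε * n ^ 2) (by positivity) (n * M + 1)
      obtain rfl : P = n * p + r := by linarith
      obtain rfl : Q = n * q + t := by linarith
      have hMq : (M : ℤ) ≤ q := by
        push_cast at hQM
        have : (n : ℤ) * M ≤ n * q := by linarith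
        exact le_of_mul_le_mul_left this (by linarith)
      refine ⟨q, hMq.trans (le_abs_self q), ?_⟩
      have hd := distNearestInt_le (q * θ - φ) p
      refine (mul_le_mul_of_nonneg_left hd (abs_nonneg _)).trans ?_
      rw [key]
      have hle : |n * q| ≤ |n * q + t| + 1 := by
        have := abs_sub (n * q + t) t
        rw [add_sub_cancel_right] at this
        linarith
      have hleR : |(n * q : ℝ)| ≤ |((n * q + t : ℤ) : ℝ)| + 1 := by exact_mod_cast hle
      rw [div_le_iff₀ (by positivity)]
      calc _ ≤ _ := mul_le_mul_of_nonneg_right hleR (abs_nonneg _)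
        _ ≤ _ := hb
        _ = _ := by field_simp
  rw [hc, ← ENNReal.ofReal_natCast n, ← ENNReal.ofReal_pow hnR.le,
    ← ENNReal.ofReal_mul (by positivity), mul_div_cancel₀ _ (by positivity)]
  rw [ENNReal.ofReal_div_of_pos two_pos]
  simp

lemma sq_mul_inhomApproxConst_exp {k n : ℕ} (hk : 1 ≤ k) (hn : 2 ≤ n) (hnk : Nat.gcd n k ≠ 1)
    {φ : ℝ} {r t : ℤ} (hrt : r + t = 1) (hrt' : |r - t| = 1) (ht : |t| ≤ 1)
    (hφ : n * φ = r - t * Real.exp (2 / k)) :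
    (n : ℝ≥0∞) ^ 2 * inhomApproxConst (Real.exp (2 / k)) φ = 1 / 2 := by
  have hgn : ((n.gcd k : ℕ) : ℤ) ∣ n := Int.natCast_dvd_natCast.mpr (Nat.gcd_dvd_left n k)
  have hg1 : ¬ ((n.gcd k : ℕ) : ℤ) ∣ 1 := by
    rw [← Nat.cast_one, Int.natCast_dvd_natCast, Nat.dvd_one]
    exact hnk
  refine sq_mul_inhomApproxConst hn ht hφ (fun ε hε => ?_) (fun ε hε M => ?_)
  · obtain ⟨N, hN⟩ := eventually_le_abs_mul_abs hk (Nat.gcd_dvd_right n k) hε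
    refine ⟨N, fun P Q hQ hP1 hQ1 => hN P Q hQ (fun h => hg1 ?_) (fun h => hg1 ?_)⟩
    · obtain ⟨x, hx⟩ := (h.sub (hgn.trans hP1)).sub (hgn.trans hQ1)
      exact ⟨x, by linarith⟩
    · rw [← hrt', dvd_abs]
      obtain ⟨x, hx⟩ := (h.sub (hgn.trans hP1)).add (hgn.trans hQ1)
      exact ⟨x, by linarith⟩
  · obtain ⟨P, Q, hM, h1, h2, hb⟩ := exists_abs_mul_abs_le hk (by omega : 0 < n) hrt' hε M
    push_cast at h1 h2
    refine ⟨P, Q, hM, ?_, ?_, hb⟩ <;> refine Int.dvd_of_mul_dvd_mul_left two_ne_zero ?_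
    · obtain ⟨x, hx⟩ := h1.add h2
      exact ⟨x, by linarith⟩
    · obtain ⟨x, hx⟩ := h1.sub h2
      exact ⟨x, by linarith⟩

theorem theorem8 (k n : ℕ) (hk : 1 ≤ k) (hn : 2 ≤ n) (hnk : Nat.gcd n k ≠ 1) :
    (n : ℝ≥0∞) ^ 2 * inhomApproxConst (Real.exp (2 / (k : ℝ))) (1 / (n : ℝ)) = 1 / 2 ∧
      (n : ℝ≥0∞) ^ 2 *
        inhomApproxConst (Real.exp (2 / (k : ℝ))) (-Real.exp (2 / (k : ℝ)) / (n : ℝ)) = 1 / 2 := by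
  have hn0 : (n : ℝ) ≠ 0 := by positivity
  constructor
  · refine sq_mul_inhomApproxConst_exp hk hn hnk (r := 1) (t := 0) (by simp) (by simp) (by simp) ?_
    field_simp
    simp
  · refine sq_mul_inhomApproxConst_exp hk hn hnk (r := 0) (t := 1) (by simp) (by simp) (by simp) ?_
    field_simp
    simp
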